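/- Let $(\Omega,\mathcal F,\Pr)$ be a probability space and $\theta:\Omega\to\Omega$ an invertible (bi-measurable) measure-preserving ergodic transformation. Let $\mathcal A$ be a finite set of outcomes, $d\in\mathbb N$, and let $\mathcal V=(V_{a;\omega})_{a\in\mathcal A}$ be a disordered perfect Kraus measurement: each $\omega\mapsto V_{a;\omega}\in M_d(\mathbb C)$ is measurable and $\sum_{a\in\mathcal A}V_{a;\omega}^\dagger V_{a;\omega}=1$ for every $\omega$. For a word $\bar a=(a_1,\dots,a_n)\in\mathcal A^n$ put $$V^{(n)}_{\bar a;\omega}=V_{a_n;\theta^n(\omega)}\cdots V_{a_1;\theta(\omega)} .$$ For a density matrix $\varrho$ (positive semidefinite, trace one) let $\mathbb Q_{\varrho;\omega}$ be the probability measure on $\mathcal A^{\mathbb N}$ that gives the set of sequences beginning with $\bar a\in\mathcal A^n$ the mass $\operatorname{tr}\big(V^{(n)}_{\bar a;\omega}\,\varrho\, V^{(n)\dagger}_{\bar a;\omega}\big)$, and let $$\rho^{(n)}_{\varrho;\omega}(\bar a)=\frac{V^{(n)}_{\bar a;\omega}\,\varrho\, V^{(n)\dagger}_{\bar a;\omega}}{\operatorname{tr}\big(V^{(n)}_{\bar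 a;\omega}\,\varrho\, V^{(n)\dagger}_{\bar a;\omega}\big)}$$ be the quantum trajectory. The purification event is $$X=\Big\{\omega\in\Omega:\ \text{for every density matrix }\varrho,\ \lim_{n\to\infty}\operatorname{tr}\big((\rho^{(n)}_{\varrho;\omega})^m\big)=1\text{ for all }m\ge 1,\ \mathbb Q_{\varrho;\omega}\text{-almost surely}\Big\}.$$ For $N\in\mathbb N$ let $\mathscr G^{(N)}_\omega$ be the set of orthogonal projections $p\in M_d(\mathbb C)$ of rank $r$ with $2\le r\le d$ such that for every $\bar a\in\mathcal A^N$ there is $\lambda\in[0,1]$ with $$p\,V^{(N)\dagger}_{\bar a;\omega}V^{(N)}_{\bar a;\omega}\,p=\lambda\, p .$$ Then for every $N\in\mathbb N$ and $\Pr$-almost every $\omega\in\Omega\setminus X$, the set $\mathscr G^{(N)}_\omega$ is nonempty. -/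

import Mathlib

open MeasureTheory ProbabilityTheory Filter Topology

section Kraus

open scoped ComplexOrder

/-- Density matrices (states) of size `d`: positive semidefinite matrices of trace one. -/
def densityMatrices (d : ℕ) : Set (Matrix (Fin d) (Fin d) ℂ) :=
  {ρ | ρ.PosSemidef ∧ ρ.trace = 1}

/-- Perfect Kraus measurements with outcome space `A`: families `(V a)` of `d × d` matrices
with `∑ a, (V a)† V a = 1`. -/
def perfectKrausMeasurements (A : Type*) [Fintype A] (d : ℕ) :
    Set (A → Matrix (Fin d) (Fin d) ℂ) :=
  {V | ∑ a, (V a).conjTranspose * V a = 1}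

variable {Ω A : Type*} [Fintype A] {d : ℕ}

/-- The matrix `V_{a_n; θ^n ω} ⋯ V_{a_2; θ^2 ω} V_{a_1; θ ω}` of a word `(a_1, …, a_n)` of
outcomes (with `a_i` stored at index `i - 1`). -/
def krausProduct (θ : Ω → Ω) (𝒱 : Ω → perfectKrausMeasurements A d) (ω : Ω) :
    (n : ℕ) → (Fin n → A) → Matrix (Fin d) (Fin d) ℂ
  | 0, _ => 1
  | n + 1, a => (𝒱 (θ^[n + 1] ω)).1 (a (Fin.last n)) * krausProduct θ 𝒱 ω n (Fin.init a)

/-- The quantum probability of observing the word `a` in the first `n` measurements. -/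
noncomputable def wordProbability (θ : Ω → Ω) (𝒱 : Ω → perfectKrausMeasurements A d)
    (ρ : densityMatrices d) (ω : Ω) (n : ℕ) (a : Fin n → A) : ENNReal :=
  ENNReal.ofReal
    (krausProduct θ 𝒱 ω n a * ρ.1 * (krausProduct θ 𝒱 ω n a).conjTranspose).trace.re

theorem sum_wordProbability_snoc (θ : Ω → Ω) (𝒱 : Ω → perfectKrausMeasurements A d)
    (ρ : densityMatrices d) (ω : Ω) (n : ℕ) (a : Fin n → A) :
    ∑ b, wordProbability θ 𝒱 ρ ω (n + 1) (Fin.snoc a b) = wordProbability θ 𝒱 ρ ω n a := by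
  unfold wordProbability
  rw [← ENNReal.ofReal_sum_of_nonneg]
  · congr 1
    simp only [krausProduct, Fin.snoc_last, Fin.init_snoc]
    rw [← Complex.re_sum]
    congr 1
    have hV := (𝒱 (θ^[n + 1] ω)).2
    simp only [perfectKrausMeasurements, Set.mem_ofPred_eq] at hV
    set W := krausProduct θ 𝒱 ω n a
    set V := (𝒱 (θ^[n + 1] ω)).1
    have h1 : ∀ b, (V b * W * ρ.1 * (V b * W).conjTranspose).trace
        = (((V b).conjTranspose * V b) * (W * ρ.1 * W.conjTranspose)).trace := by
      intro b
      rw [Matrix.conjTranspose_mul, Matrix.mul_assoc (V b) W, ← Matrix.mul_assoc _ W.conjTranspose,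
        Matrix.trace_mul_comm]
      simp only [Matrix.mul_assoc]
    simp only [h1]
    rw [← Matrix.trace_sum, ← Finset.sum_mul, hV, one_mul]
  · intro b _
    have := (ρ.2.1.mul_mul_conjTranspose_same
      (krausProduct θ 𝒱 ω (n + 1) (Fin.snoc a b))).trace_nonneg
    exact (Complex.le_def.1 this).1

end Kraus

section Extension

/-- Consistent word probabilities on a finite alphabet extend to a law on infinite sequences. -/
theorem exists_measure_of_consistent {A : Type*} [Fintype A] [MeasurableSpace A]
    [MeasurableSingletonClass A] (f : (n : ℕ) → (Fin n → A) → ENNReal)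
    (h0 : ∀ a, f 0 a = 1) (hs : ∀ n a, ∑ b, f (n + 1) (Fin.snoc a b) = f n a) :
    ∃ Q : Measure (ℕ → A), IsProbabilityMeasure Q ∧
      ∀ n (a : Fin n → A), Q {x | ∀ i : Fin n, x i = a i} = f n a := by
  classical
  have hle : ∀ n a, f n a ≤ 1 := by
    intro n
    induction n with
    | zero => intro a; exact (h0 a).le
    | succ n ih =>
      intro a
      refine le_trans ?_ (ih (Fin.init a))
      rw [← hs n (Fin.init a)]
      calc f (n + 1) a = f (n + 1) (Fin.snoc (Fin.init a) (a (Fin.last n))) := by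
            rw [Fin.snoc_init_self]
        _ ≤ _ := Finset.single_le_sum
            (f := fun b => f (n + 1) (Fin.snoc (Fin.init a) b)) (fun _ _ => zero_le)
            (Finset.mem_univ _)
  have hne : ∀ n a, f n a ≠ ⊤ := fun n a => ((hle n a).trans_lt ENNReal.one_lt_top).ne
  have hA : Nonempty A := by
    by_contra hA
    rw [not_nonempty_iff] at hA
    have := hs 0 Fin.elim0
    rw [h0, Finset.univ_eq_empty, Finset.sum_empty] at this
    exact zero_ne_one this
  have hstep : ∀ n (a : Fin n → A), ∃ p : PMF A, ∀ b, f n a * p b = f (n + 1) (Fin.snoc a b) := by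
    intro n a
    by_cases hz : f n a = 0
    · refine ⟨PMF.pure hA.some, fun b => ?_⟩
      rw [hz, zero_mul]
      have := hs n a
      rw [hz, Finset.sum_eq_zero_iff] at this
      exact (this b (Finset.mem_univ _)).symm
    · refine ⟨PMF.ofFintype (fun b => (f n a)⁻¹ * f (n + 1) (Fin.snoc a b)) ?_, fun b => ?_⟩
      · rw [← Finset.mul_sum, hs, ENNReal.inv_mul_cancel hz (hne n a)]
      · rw [PMF.ofFintype_apply, ← mul_assoc, ENNReal.mul_inv_cancel hz (hne n a), one_mul]
  choose p hp using hstep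
  let hist : (n : ℕ) → (Finset.Iic n → A) → Fin (n + 1) → A :=
    fun n h i => h ⟨i, Finset.mem_Iic.2 (Nat.lt_succ_iff.1 i.2)⟩
  let κ : (n : ℕ) → Kernel (Finset.Iic n → A) A :=
    fun n => Kernel.ofFunOfCountable fun h => (p (n + 1) (hist n h)).toMeasure
  have hκ : ∀ n, IsMarkovKernel (κ n) := fun n =>
    ⟨fun h => by change IsProbabilityMeasure (p (n + 1) (hist n h)).toMeasure; infer_instance⟩
  let μ₀ : Measure A := (p 0 Fin.elim0).toMeasure
  let Q : Measure (ℕ → A) := Kernel.trajMeasure (X := fun _ => A) μ₀ κ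
  have hQ : IsProbabilityMeasure Q := by dsimp only [Q]; infer_instance
  refine ⟨Q, hQ, fun n => ?_⟩
  have hset : ∀ n (a : Fin (n + 1) → A), {x : ℕ → A | ∀ i : Fin (n + 1), x i = a i} =
      (Preorder.frestrictLe (π := fun _ => A) n) ⁻¹'
        {fun i : Finset.Iic n => a ⟨i.1, Nat.lt_succ_iff.2 (Finset.mem_Iic.1 i.2)⟩} := by
    intro n a
    ext x
    simp only [Set.mem_ofPred_eq, Set.mem_preimage, Set.mem_singleton_iff, funext_iff]
    constructor
    · intro h i
      exact h ⟨i, Nat.lt_succ_iff.2 (Finset.mem_Iic.1 i.2)⟩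
    · intro h i
      exact h ⟨i, Finset.mem_Iic.2 (Nat.lt_succ_iff.1 i.2)⟩
  induction n with
  | zero => intro a; simp [h0]
  | succ n ih =>
    intro a
    have hfa : f (n + 1) a = f n (Fin.init a) * p n (Fin.init a) (a (Fin.last n)) := by
      rw [hp, Fin.snoc_init_self]
    rw [hfa, ← ih]
    cases n with
    | zero =>
      have hmap : Q.map (fun x => x 0) = μ₀ := by
        have h1 : Q.map (Preorder.frestrictLe (π := fun _ => A) 0) =
            μ₀.map (MeasurableEquiv.piUnique (fun _ : Finset.Iic 0 => A)).symm := by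
          dsimp only [Q]
          rw [Kernel.trajMeasure, Measure.map_comp _ _ (by fun_prop),
            Kernel.traj_map_frestrictLe, Kernel.partialTraj_self, Measure.id_comp]
        have h2 : (fun x : ℕ → A => x 0) =
            (MeasurableEquiv.piUnique (fun _ : Finset.Iic 0 => A)) ∘
              (Preorder.frestrictLe (π := fun _ => A) 0) := rfl
        rw [h2, ← Measure.map_map (by fun_prop) (by fun_prop), h1,
          Measure.map_map (by fun_prop) (by fun_prop), MeasurableEquiv.self_comp_symm,
          Measure.map_id]
      have hsing : {x : ℕ → A | ∀ i : Fin (0 + 1), x i = a i} = (fun x => x 0) ⁻¹' {a 0} := by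
        ext x; simp
      rw [hsing, ← Measure.map_apply (by fun_prop) (measurableSet_singleton _), hmap]
      have he : (Fin.init a : Fin 0 → A) = Fin.elim0 := Subsingleton.elim _ _
      rw [he]
      simp only [μ₀]
      rw [PMF.toMeasure_apply_singleton _ _ (measurableSet_singleton _)]
      simp
    | succ n =>
      have hcp := Kernel.map_frestrictLe_trajMeasure_compProd_eq_map_trajMeasure
        (X := fun _ => A) (μ₀ := μ₀) (κ := κ) (a := n)
      change Q.map _ ⊗ₘ κ n = Q.map _ at hcp
      let h : Finset.Iic n → A :=
        fun i => Fin.init a ⟨i, Nat.lt_succ_iff.2 (Finset.mem_Iic.1 i.2)⟩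
      have hsplit : {x : ℕ → A | ∀ i : Fin (n + 1 + 1), x i = a i} =
          (fun x => (Preorder.frestrictLe (π := fun _ => A) n x, x (n + 1))) ⁻¹'
            ({h} ×ˢ {a (Fin.last (n + 1))}) := by
        have := hset n (Fin.init a)
        ext x
        have hx := Set.ext_iff.1 this x
        simp only [Set.mem_ofPred_eq, Set.mem_preimage, Set.mem_prod] at hx ⊢
        rw [← hx, Fin.forall_fin_succ']
        rfl
      have hhist : hist n h = Fin.init a := rfl
      rw [hsplit, ← Measure.map_apply (by fun_prop) (by measurability), ← hcp,
        Measure.compProd_apply_prod (by measurability) (by measurability),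
        Measure.restrict_singleton, lintegral_smul_measure, lintegral_dirac,
        Measure.map_apply (by fun_prop) (by measurability), hset n (Fin.init a), smul_eq_mul]
      congr 1
      change (p (n + 1) (hist n h)).toMeasure _ = _
      rw [hhist, PMF.toMeasure_apply_singleton _ _ (measurableSet_singleton _)]

end Extension

section Trajectories

variable {Ω A : Type*} [Fintype A] {d : ℕ}

theorem exists_quantumProbability [MeasurableSpace A] [MeasurableSingletonClass A]
    (θ : Ω → Ω) (𝒱 : Ω → perfectKrausMeasurements A d) (ρ : densityMatrices d) (ω : Ω) :
    ∃ Q : Measure (ℕ → A), IsProbabilityMeasure Q ∧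
      ∀ n (a : Fin n → A),
        Q {x | ∀ i : Fin n, x i = a i} = wordProbability θ 𝒱 ρ ω n a := by
  refine exists_measure_of_consistent _ (fun a => ?_) (sum_wordProbability_snoc θ 𝒱 ρ ω)
  simp [wordProbability, krausProduct, ρ.2.2]

/-- The quantum probability on infinite sequences of outcomes: the (unique) probability measure
giving each cylinder set of a word `a` the mass `tr (V_a ρ V_a†)`. The outcome of the
`(i + 1)`-st measurement is stored at index `i`. -/
noncomputable def quantumProbability [MeasurableSpace A] [MeasurableSingletonClass A]
    (θ : Ω → Ω) (𝒱 : Ω → perfectKrausMeasurements A d) (ρ : densityMatrices d) (ω : Ω) :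
    Measure (ℕ → A) :=
  (exists_quantumProbability θ 𝒱 ρ ω).choose

theorem quantumProbability_cylinder [MeasurableSpace A] [MeasurableSingletonClass A]
    (θ : Ω → Ω) (𝒱 : Ω → perfectKrausMeasurements A d) (ρ : densityMatrices d) (ω : Ω)
    (n : ℕ) (a : Fin n → A) :
    quantumProbability θ 𝒱 ρ ω {x | ∀ i : Fin n, x i = a i} = wordProbability θ 𝒱 ρ ω n a :=
  (exists_quantumProbability θ 𝒱 ρ ω).choose_spec.2 n a

instance quantumProbability.instIsProbabilityMeasure [MeasurableSpace A]
    [MeasurableSingletonClass A]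
    (θ : Ω → Ω) (𝒱 : Ω → perfectKrausMeasurements A d) (ρ : densityMatrices d) (ω : Ω) :
    IsProbabilityMeasure (quantumProbability θ 𝒱 ρ ω) :=
  (exists_quantumProbability θ 𝒱 ρ ω).choose_spec.1

/-- The quantum trajectory: the state after the first `n` measurements with outcomes
`x 0, …, x (n - 1)`. On words of probability zero (where the denominator vanishes) its value
plays no role. -/
noncomputable def quantumTrajectory (θ : Ω → Ω) (𝒱 : Ω → perfectKrausMeasurements A d)
    (ρ : densityMatrices d) (ω : Ω) (n : ℕ) (x : ℕ → A) : Matrix (Fin d) (Fin d) ℂ :=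
  let W := krausProduct θ 𝒱 ω n (fun i => x i)
  (W * ρ.1 * W.conjTranspose).trace⁻¹ • (W * ρ.1 * W.conjTranspose)

/-- The purification event: the set of disorder realizations `ω` such that for every initial
state `ρ`, almost surely with respect to the quantum probability, all moments `tr (ρ_n ^ m)`,
`m ≥ 1`, of the quantum trajectory converge to `1`. -/
def purificationEvent [MeasurableSpace A] [MeasurableSingletonClass A]
    (θ : Ω → Ω) (𝒱 : Ω → perfectKrausMeasurements A d) : Set Ω :=
  {ω | ∀ ρ : densityMatrices d, ∀ᵐ x ∂quantumProbability θ 𝒱 ρ ω, ∀ m : ℕ, 1 ≤ m →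
    Tendsto (fun n => (quantumTrajectory θ 𝒱 ρ ω n x ^ m).trace) atTop (𝓝 1)}

/-- The `N`-gray projections of rank `r`: orthogonal projections `p` of rank `r` such that
for every word `a` of length `N`, `p V_a† V_a p = λ p` for some `λ ∈ [0, 1]`. -/
def grayProjectionsOfRank (θ : Ω → Ω) (𝒱 : Ω → perfectKrausMeasurements A d) (N r : ℕ)
    (ω : Ω) : Set (Matrix (Fin d) (Fin d) ℂ) :=
  {p | IsStarProjection p ∧ p.rank = r ∧ ∀ a : Fin N → A, ∃ l : ℝ, 0 ≤ l ∧ l ≤ 1 ∧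
    p * (krausProduct θ 𝒱 ω N a).conjTranspose * krausProduct θ 𝒱 ω N a * p = (l : ℂ) • p}

/-- The `N`-gray projections (of rank between `2` and `d`). -/
def grayProjections (θ : Ω → Ω) (𝒱 : Ω → perfectKrausMeasurements A d) (N : ℕ) (ω : Ω) :
    Set (Matrix (Fin d) (Fin d) ℂ) :=
  ⋃ r ∈ Set.Icc 2 d, grayProjectionsOfRank θ 𝒱 N r ω

end Trajectories

/-! Write `ρ = σ σᴴ` and let `Z_n` be `V^{(n)} σ` scaled to Frobenius norm one along the observed
word. The trajectory is `Z_n Z_nᴴ`, and the Gram matrix `Z_nᴴ Z_n` has the same power traces. Unlike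
the state, the Gram matrix is a bounded martingale under the quantum probability
(`isWordMartingale_normalizedKraus`), because normalization cancels against the word probability and
`∑ Vᴴ V = 1`. Hence it converges almost surely to some `M`. The conditional variances of its
`N`-step increments are almost surely summable. With `B` the operator of a word `a` of length `N` in
the environment `θ^n ω`, this forces `(B Z_n)ᴴ (B Z_n) - ‖B Z_n‖² Z_nᴴ Z_n → 0` for every `a`
(`ae_gram_normalizedKraus`). By Poincaré recurrence (`ae_mapClusterPt_iterate`), the operators at
`θ^n ω` return along a subsequence to those at `ω`. By compactness `Z_n → Y` along a further one. In
the limit `(B Y)ᴴ (B Y) = λ Yᴴ Y` with `B` now taken at `ω`, so the projection onto the range of `Y`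
is gray. Off the purification event, some state and outcome sequence give `tr (M ^ m) ≠ 1` for some
`m ≥ 1`; since `Yᴴ Y = M` has trace one, `Y` must have rank at least two. -/

section SequenceMartingale

/-! ### Martingales indexed by finite words and their increments. -/

variable {A : Type*}

/-- The first `n` letters of a sequence. -/
def sequencePrefix (n : ℕ) (x : ℕ → A) : Fin n → A := fun i => x i

theorem sum_append [Fintype A] {n N : ℕ} (F : (Fin (n + N) → A) → ℝ) :
    ∑ v, F v = ∑ w : Fin n → A, ∑ a : Fin N → A, F (Fin.append w a) := by
  rw [← (Fin.appendEquiv n N).sum_comp, Fintype.sum_prod_type]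
  rfl

variable [MeasurableSpace A]

theorem measurable_sequencePrefix (n : ℕ) : Measurable (sequencePrefix n : (ℕ → A) → Fin n → A) :=
  measurable_pi_lambda _ fun _ => measurable_pi_apply _

/-- The filtration generated by the successive letters of a sequence. -/
def prefixFiltration (A : Type*) [MeasurableSpace A] :
    Filtration ℕ (inferInstance : MeasurableSpace (ℕ → A)) where
  seq n := MeasurableSpace.comap (sequencePrefix n) inferInstance
  mono' := by
    intro n m hnm
    rintro s ⟨t, ht, rfl⟩
    refine ⟨(fun w : Fin m → A => fun i : Fin n => w (Fin.castLE hnm i)) ⁻¹' t, ?_, rfl⟩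
    exact (measurable_pi_lambda _ fun _ => measurable_pi_apply _) ht
  le' := fun n => by
    rintro s ⟨t, ht, rfl⟩
    exact (measurable_pi_lambda _ fun _ => measurable_pi_apply _) ht

/-- The probability of seeing the word `w` first. -/
noncomputable def prefixProbability (Q : Measure (ℕ → A)) (n : ℕ) (w : Fin n → A) : ℝ :=
  Q.real {x | ∀ i : Fin n, x i = w i}

variable (Q : Measure (ℕ → A))

theorem prefixProbability_eq (n : ℕ) (w : Fin n → A) :
    prefixProbability Q n w = Q.real (sequencePrefix n ⁻¹' {w}) := by
  unfold prefixProbability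
  congr 1
  ext x
  simp [sequencePrefix, funext_iff]

theorem prefixProbability_nonneg (n : ℕ) (w : Fin n → A) : 0 ≤ prefixProbability Q n w :=
  measureReal_nonneg

theorem prefixProbability_append_le [IsProbabilityMeasure Q] {n N : ℕ} (w : Fin n → A) (a : Fin N → A) :
    prefixProbability Q (n + N) (Fin.append w a) ≤ prefixProbability Q n w := by
  refine measureReal_mono fun x hx i => ?_
  simpa using hx (Fin.castAdd N i)

variable [Fintype A] [MeasurableSingletonClass A] [IsProbabilityMeasure Q]

theorem integral_comp_sequencePrefix (n : ℕ) (F : (Fin n → A) → ℝ) :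
    ∫ x, F (sequencePrefix n x) ∂Q = ∑ w, prefixProbability Q n w * F w := by
  classical
  have hF : Measurable F := measurable_of_countable F
  rw [← integral_map (φ := sequencePrefix n) (f := F)
    (measurable_sequencePrefix n).aemeasurable hF.aestronglyMeasurable]
  have : IsProbabilityMeasure (Q.map (sequencePrefix n)) :=
    Measure.isProbabilityMeasure_map (measurable_sequencePrefix n).aemeasurable
  rw [integral_fintype Integrable.of_finite]
  refine Finset.sum_congr rfl fun w _ => ?_
  rw [map_measureReal_apply (measurable_sequencePrefix n) (measurableSet_singleton _),
    prefixProbability_eq, smul_eq_mul]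

theorem integrable_comp_sequencePrefix (n : ℕ) (F : (Fin n → A) → ℝ) :
    Integrable (fun x => F (sequencePrefix n x)) Q := by
  refine Integrable.comp_measurable ?_ (measurable_sequencePrefix n)
  have : IsProbabilityMeasure (Q.map (sequencePrefix (A := A) n)) :=
    Measure.isProbabilityMeasure_map (measurable_sequencePrefix n).aemeasurable
  exact Integrable.of_finite

theorem sum_prefixProbability (n : ℕ) : ∑ w, prefixProbability Q n w = 1 := by
  have := integral_comp_sequencePrefix Q n (fun _ => 1)
  simpa using this.symm

/-- There are finitely many words of each length, so the null cylinders together form a null set.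
This makes every normalization along a typical sequence legitimate. -/
theorem ae_prefixProbability_pos :
    ∀ᵐ x ∂Q, ∀ n, 0 < prefixProbability Q n (sequencePrefix n x) := by
  rw [ae_all_iff]
  intro n
  have h : ∀ᵐ x ∂Q, ∀ w, prefixProbability Q n w = 0 → sequencePrefix n x ≠ w := by
    rw [ae_all_iff]
    intro w
    by_cases hw : prefixProbability Q n w = 0
    · rw [prefixProbability_eq, measureReal_eq_zero_iff] at hw
      have := measure_eq_zero_iff_ae_notMem.1 hw
      filter_upwards [this] with x hx _ h
      exact hx h
    · simp [hw]
  filter_upwards [h] with x hx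
  exact lt_of_le_of_ne (prefixProbability_nonneg Q n _) fun h0 => hx _ h0.symm rfl

/-- A function `u` of words is a martingale for `Q` if its average over all extensions of a word
by `N` letters is its value at that word. -/
def IsWordMartingale (u : (n : ℕ) → (Fin n → A) → ℝ) : Prop :=
  ∀ n N (w : Fin n → A), ∑ a : Fin N → A,
    prefixProbability Q (n + N) (Fin.append w a) * u (n + N) (Fin.append w a) =
      prefixProbability Q n w * u n w

variable {Q} {u : (n : ℕ) → (Fin n → A) → ℝ}

theorem sum_append_prefixProbability {n : ℕ} (N : ℕ) (w : Fin n → A) :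
    ∑ a : Fin N → A, prefixProbability Q (n + N) (Fin.append w a) = prefixProbability Q n w := by
  classical
  have h1 := integral_comp_sequencePrefix Q n (fun v => if v = w then 1 else 0)
  have h2 := integral_comp_sequencePrefix Q (n + N)
    (fun v => if (fun i : Fin n => v (Fin.castAdd N i)) = w then 1 else 0)
  rw [sum_append] at h2
  -- The same indicator of a cylinder is integrated once at level `n` and once at level `n + N`.
  have h3 : (fun x : ℕ → A => if sequencePrefix n x = w then (1 : ℝ) else 0) =
    (fun x => if (fun i : Fin n => sequencePrefix (n + N) x (Fin.castAdd N i)) = w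
      then 1 else 0) := rfl
  rw [h3, h2] at h1
  simpa using h1

theorem IsWordMartingale.martingale (hu : IsWordMartingale Q u) :
    Martingale (fun n x => u n (sequencePrefix n x)) (prefixFiltration A) Q := by
  classical
  refine martingale_of_setIntegral_eq_succ (fun n => ?_)
    (fun n => integrable_comp_sequencePrefix Q n (u n)) (fun n s hs => ?_)
  · refine Measurable.stronglyMeasurable ?_
    exact (measurable_of_countable (u n)).comp (comap_measurable _)
  · obtain ⟨t, ht, rfl⟩ := hs
    rw [← integral_indicator (measurable_sequencePrefix n ht),
      ← integral_indicator (measurable_sequencePrefix n ht)]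
    have h1 := integral_comp_sequencePrefix Q n (fun v => if v ∈ t then u n v else 0)
    have h2 := integral_comp_sequencePrefix Q (n + 1)
      (fun v => if (fun i : Fin n => v (Fin.castAdd 1 i)) ∈ t then u (n + 1) v else 0)
    refine Eq.trans ?_ (h1.trans (Eq.trans ?_ (h2.symm.trans ?_)))
    · rfl
    · rw [sum_append]
      refine Finset.sum_congr rfl fun w _ => ?_
      by_cases hw : w ∈ t
      · simp [hw, hu n 1 w]
      · simp [hw]
    · rfl

theorem IsWordMartingale.ae_exists_tendsto (hu : IsWordMartingale Q u)
    (hb : ∀ n w, |u n w| ≤ 1) :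
    ∀ᵐ x ∂Q, ∃ c, Tendsto (fun n => u n (sequencePrefix n x)) atTop (𝓝 c) := by
  refine hu.martingale.submartingale.exists_ae_tendsto_of_bdd (R := 1) fun n => ?_
  refine (eLpNorm_le_of_ae_bound (C := 1) (ae_of_all _ fun x => hb n _)).trans ?_
  simp

/-- The conditional second moment of the increment of a word function over `N` steps. -/
noncomputable def conditionalVariation (Q : Measure (ℕ → A)) (u : (n : ℕ) → (Fin n → A) → ℝ)
    (N n : ℕ) (w : Fin n → A) : ℝ :=
  ∑ a : Fin N → A, prefixProbability Q (n + N) (Fin.append w a) / prefixProbability Q n w *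
    (u (n + N) (Fin.append w a) - u n w) ^ 2

theorem conditionalVariation_nonneg (N n : ℕ) (w : Fin n → A) :
    0 ≤ conditionalVariation Q u N n w :=
  Finset.sum_nonneg fun _ _ => mul_nonneg
    (div_nonneg (prefixProbability_nonneg Q _ _) (prefixProbability_nonneg Q _ _)) (sq_nonneg _)

/-- Orthogonality of martingale increments: the mean square of an increment is the increase of the
second moment, which makes the sum over `n` controllable. -/
theorem IsWordMartingale.integral_conditionalVariation (hu : IsWordMartingale Q u) (N n : ℕ) :
    ∫ x, conditionalVariation Q u N n (sequencePrefix n x) ∂Q =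
      ∑ w, prefixProbability Q (n + N) w * u (n + N) w ^ 2 -
        ∑ w, prefixProbability Q n w * u n w ^ 2 := by
  rw [integral_comp_sequencePrefix, sum_append, ← Finset.sum_sub_distrib]
  refine Finset.sum_congr rfl fun w _ => ?_
  have h1 : prefixProbability Q n w * conditionalVariation Q u N n w =
      ∑ a : Fin N → A, prefixProbability Q (n + N) (Fin.append w a) *
        (u (n + N) (Fin.append w a) - u n w) ^ 2 := by
    unfold conditionalVariation
    rw [Finset.mul_sum]
    refine Finset.sum_congr rfl fun a _ => ?_
    -- On a null word the quotient is `0` by convention, and all its extensions are null too.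
    by_cases h0 : prefixProbability Q n w = 0
    · have := prefixProbability_append_le Q w a
      have h2 := prefixProbability_nonneg Q _ (Fin.append w a)
      rw [h0] at this
      rw [le_antisymm this h2, h0]
      simp
    · field_simp
  rw [h1]
  have h2 : ∀ a : Fin N → A, prefixProbability Q (n + N) (Fin.append w a) *
        (u (n + N) (Fin.append w a) - u n w) ^ 2 =
      prefixProbability Q (n + N) (Fin.append w a) * u (n + N) (Fin.append w a) ^ 2 -
      2 * u n w * (prefixProbability Q (n + N) (Fin.append w a) * u (n + N) (Fin.append w a)) +
      u n w ^ 2 * prefixProbability Q (n + N) (Fin.append w a) := fun a => by ring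
  simp only [h2]
  rw [Finset.sum_add_distrib, Finset.sum_sub_distrib, ← Finset.mul_sum, ← Finset.mul_sum,
    hu n N w, sum_append_prefixProbability]
  ring

/-- One-step differences telescope to at most `1`; an `N`-step difference is a sum of `N` shifted
one-step differences. -/
theorem summable_shift_sub {e : ℕ → ℝ} (h0 : ∀ n, 0 ≤ e n) (h1 : ∀ n, e n ≤ 1)
    (hmono : ∀ n, e n ≤ e (n + 1)) (N : ℕ) : Summable fun n => e (n + N) - e n := by
  have hbase : Summable fun n => e (n + 1) - e n := by
    refine summable_of_sum_range_le (c := 1) (fun n => sub_nonneg.2 (hmono n)) fun n => ?_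
    rw [Finset.sum_range_sub]
    linarith [h0 0, h1 n]
  induction N with
  | zero => simp
  | succ N ih =>
    have := ((summable_nat_add_iff N).2 hbase).add ih
    refine this.congr fun n => ?_
    rw [show n + (N + 1) = n + N + 1 by ring]
    ring

theorem IsWordMartingale.ae_tendsto_conditionalVariation (hu : IsWordMartingale Q u)
    (hb : ∀ n w, |u n w| ≤ 1) (N : ℕ) :
    ∀ᵐ x ∂Q, Tendsto (fun n => conditionalVariation Q u N n (sequencePrefix n x)) atTop (𝓝 0) := by
  set e : ℕ → ℝ := fun n => ∑ w, prefixProbability Q n w * u n w ^ 2 with he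
  have hint : ∀ n, Integrable (fun x => conditionalVariation Q u N n (sequencePrefix n x)) Q :=
    fun n => integrable_comp_sequencePrefix Q n _
  have hsum : Summable fun n => ∫ x, conditionalVariation Q u N n (sequencePrefix n x) ∂Q := by
    simp only [hu.integral_conditionalVariation]
    refine summable_shift_sub (e := e) (fun n => ?_) (fun n => ?_) (fun n => ?_) N
    · exact Finset.sum_nonneg fun w _ => mul_nonneg (prefixProbability_nonneg Q _ _) (sq_nonneg _)
    · rw [← sum_prefixProbability Q n]
      refine Finset.sum_le_sum fun w _ => ?_
      exact mul_le_of_le_one_right (prefixProbability_nonneg Q _ _)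
        ((sq_le_one_iff_abs_le_one _).2 (hb n w))
    -- Second moments increase because their one-step difference is the integral of a nonnegative
    -- variation.
    · have := hu.integral_conditionalVariation 1 n
      rw [← sub_nonneg, ← this]
      exact integral_nonneg fun x => conditionalVariation_nonneg _ _ _
  -- Tonelli: the series of variations has finite integral, so it converges almost everywhere and
  -- its terms tend to `0`.
  have hlin : ∫⁻ x, ∑' n, ENNReal.ofReal (conditionalVariation Q u N n (sequencePrefix n x)) ∂Q
      ≠ ⊤ := by
    rw [lintegral_tsum fun n => (hint n).1.aemeasurable.ennreal_ofReal]
    simp only [← fun n => ofReal_integral_eq_lintegral_ofReal (hint n)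
      (ae_of_all _ fun x => conditionalVariation_nonneg _ _ _)]
    rw [← ENNReal.ofReal_tsum_of_nonneg _ hsum]
    · exact ENNReal.ofReal_ne_top
    · exact fun n => integral_nonneg fun x => conditionalVariation_nonneg _ _ _
  have hae := ae_lt_top' (AEMeasurable.tsum fun n => (hint n).1.aemeasurable.ennreal_ofReal) hlin
  filter_upwards [hae] with x hx
  have h := ENNReal.summable_toReal hx.ne
  refine h.tendsto_atTop_zero.congr fun n => ?_
  exact ENNReal.toReal_ofReal (conditionalVariation_nonneg _ _ _)

/-- For a weight `t ∈ [0, 1]`, `(t Δ)² ≤ t Δ²`, and the latter is one term of the conditional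
variation. The weight cannot be dropped, since the extension by `a` may be increasingly unlikely. -/
theorem IsWordMartingale.ae_tendsto_weighted_increment (hu : IsWordMartingale Q u)
    (hb : ∀ n w, |u n w| ≤ 1) {N : ℕ} (a : Fin N → A) :
    ∀ᵐ x ∂Q, Tendsto (fun n =>
      prefixProbability Q (n + N) (Fin.append (sequencePrefix n x) a) /
        prefixProbability Q n (sequencePrefix n x) *
      (u (n + N) (Fin.append (sequencePrefix n x) a) - u n (sequencePrefix n x)))
      atTop (𝓝 0) := by
  filter_upwards [hu.ae_tendsto_conditionalVariation hb N] with x hx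
  have hs := (Real.continuous_sqrt.tendsto 0).comp hx
  rw [Real.sqrt_zero] at hs
  refine squeeze_zero_norm (fun n => ?_) hs
  rw [Real.norm_eq_abs, Function.comp]
  refine Real.abs_le_sqrt ?_
  set w := sequencePrefix n x
  have h1 : 0 ≤ prefixProbability Q (n + N) (Fin.append w a) / prefixProbability Q n w :=
    div_nonneg (prefixProbability_nonneg Q _ _) (prefixProbability_nonneg Q _ _)
  have h2 : prefixProbability Q (n + N) (Fin.append w a) / prefixProbability Q n w ≤ 1 :=
    div_le_one_of_le₀ (prefixProbability_append_le Q w a) (prefixProbability_nonneg Q _ _)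
  refine le_trans ?_ (Finset.single_le_sum (f := fun a : Fin N → A =>
    prefixProbability Q (n + N) (Fin.append w a) / prefixProbability Q n w *
    (u (n + N) (Fin.append w a) - u n w) ^ 2) (fun a _ => mul_nonneg
    (div_nonneg (prefixProbability_nonneg Q _ _) (prefixProbability_nonneg Q _ _)) (sq_nonneg _))
    (Finset.mem_univ a))
  rw [mul_pow]
  refine mul_le_mul_of_nonneg_right ?_ (sq_nonneg _)
  nlinarith

end SequenceMartingale

/-! ### Gram matrices, Frobenius normalization and range projections. -/

section GramMatrices

open scoped Matrix ComplexOrder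

variable {d : ℕ}

/-- The trace of `Xᴴ X`, i.e. the square of the Frobenius norm of `X`. -/
noncomputable def frobeniusSq (X : Matrix (Fin d) (Fin d) ℂ) : ℝ := (Xᴴ * X).trace.re

theorem frobeniusSq_eq_sum (X : Matrix (Fin d) (Fin d) ℂ) :
    frobeniusSq X = ∑ j, ∑ i, ‖X i j‖ ^ 2 := by
  unfold frobeniusSq Matrix.trace
  rw [Complex.re_sum]
  refine Finset.sum_congr rfl fun j _ => ?_
  rw [Matrix.diag_apply, Matrix.mul_apply, Complex.re_sum]
  refine Finset.sum_congr rfl fun i _ => ?_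
  rw [Matrix.conjTranspose_apply, Complex.star_def, ← Complex.normSq_eq_conj_mul_self,
    Complex.normSq_eq_norm_sq, Complex.ofReal_re]

theorem ofReal_frobeniusSq (X : Matrix (Fin d) (Fin d) ℂ) :
    (frobeniusSq X : ℂ) = (Xᴴ * X).trace := by
  rw [frobeniusSq_eq_sum, Matrix.trace]
  push_cast
  refine Finset.sum_congr rfl fun j _ => ?_
  rw [Matrix.diag_apply, Matrix.mul_apply]
  refine Finset.sum_congr rfl fun i _ => ?_
  rw [Matrix.conjTranspose_apply, Complex.star_def, ← Complex.normSq_eq_conj_mul_self,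
    Complex.normSq_eq_norm_sq]
  push_cast
  rfl

theorem frobeniusSq_nonneg (X : Matrix (Fin d) (Fin d) ℂ) : 0 ≤ frobeniusSq X := by
  rw [frobeniusSq_eq_sum]
  positivity

theorem sum_norm_sq_col_le_frobeniusSq (X : Matrix (Fin d) (Fin d) ℂ) (j : Fin d) :
    ∑ i, ‖X i j‖ ^ 2 ≤ frobeniusSq X := by
  rw [frobeniusSq_eq_sum]
  exact Finset.single_le_sum (f := fun j => ∑ i, ‖X i j‖ ^ 2)
    (fun j _ => Finset.sum_nonneg fun _ _ => sq_nonneg _) (Finset.mem_univ j)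

theorem norm_sq_entry_le_frobeniusSq (X : Matrix (Fin d) (Fin d) ℂ) (i j : Fin d) :
    ‖X i j‖ ^ 2 ≤ frobeniusSq X :=
  (Finset.single_le_sum (f := fun i => ‖X i j‖ ^ 2) (fun _ _ => sq_nonneg _)
    (Finset.mem_univ i)).trans (sum_norm_sq_col_le_frobeniusSq X j)

theorem eq_zero_of_frobeniusSq_eq_zero {X : Matrix (Fin d) (Fin d) ℂ} (h : frobeniusSq X = 0) :
    X = 0 := by
  ext i j
  have := norm_sq_entry_le_frobeniusSq X i j
  rw [h] at this
  simpa using le_antisymm this (sq_nonneg _)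

/-- Supplies the uniform bound `1` for the martingale of normalized Gram matrices. -/
theorem norm_gram_entry_le_frobeniusSq (X : Matrix (Fin d) (Fin d) ℂ) (i j : Fin d) :
    ‖(Xᴴ * X) i j‖ ≤ frobeniusSq X := by
  rw [Matrix.mul_apply]
  calc ‖∑ k, Xᴴ i k * X k j‖ ≤ ∑ k, ‖X k i‖ * ‖X k j‖ := by
        refine (norm_sum_le _ _).trans (Finset.sum_le_sum fun k _ => ?_)
        rw [norm_mul, Matrix.conjTranspose_apply, norm_star]
    _ ≤ ∑ k, (‖X k i‖ ^ 2 + ‖X k j‖ ^ 2) / 2 := by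
        refine Finset.sum_le_sum fun k _ => ?_
        nlinarith [sq_nonneg (‖X k i‖ - ‖X k j‖)]
    _ = (∑ k, ‖X k i‖ ^ 2 + ∑ k, ‖X k j‖ ^ 2) / 2 := by
        rw [← Finset.sum_div, Finset.sum_add_distrib]
    _ ≤ frobeniusSq X := by
        linarith [sum_norm_sq_col_le_frobeniusSq X i, sum_norm_sq_col_le_frobeniusSq X j]

/-- The matrix `X` scaled to Frobenius norm one. -/
noncomputable def frobeniusNormalize (X : Matrix (Fin d) (Fin d) ℂ) : Matrix (Fin d) (Fin d) ℂ :=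
  (√(frobeniusSq X))⁻¹ • X

theorem gram_mul_frobeniusNormalize (B X : Matrix (Fin d) (Fin d) ℂ) :
    (B * frobeniusNormalize X)ᴴ * (B * frobeniusNormalize X) =
      (frobeniusSq X)⁻¹ • ((B * X)ᴴ * (B * X)) := by
  unfold frobeniusNormalize
  rw [Matrix.mul_smul, Matrix.conjTranspose_smul, star_trivial, Matrix.smul_mul, Matrix.mul_smul,
    smul_smul, ← mul_inv, Real.mul_self_sqrt (frobeniusSq_nonneg X)]

theorem gram_frobeniusNormalize (X : Matrix (Fin d) (Fin d) ℂ) :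
    (frobeniusNormalize X)ᴴ * frobeniusNormalize X = (frobeniusSq X)⁻¹ • (Xᴴ * X) := by
  simpa using gram_mul_frobeniusNormalize 1 X

theorem frobeniusNormalize_mul_conjTranspose (X : Matrix (Fin d) (Fin d) ℂ) :
    frobeniusNormalize X * (frobeniusNormalize X)ᴴ = (frobeniusSq X)⁻¹ • (X * Xᴴ) := by
  unfold frobeniusNormalize
  rw [Matrix.conjTranspose_smul, star_trivial, Matrix.smul_mul, Matrix.mul_smul,
    smul_smul, ← mul_inv, Real.mul_self_sqrt (frobeniusSq_nonneg X)]

theorem frobeniusSq_smul_gram_frobeniusNormalize (X : Matrix (Fin d) (Fin d) ℂ) :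
    frobeniusSq X • ((frobeniusNormalize X)ᴴ * frobeniusNormalize X) = Xᴴ * X := by
  by_cases h : frobeniusSq X = 0
  · rw [h, eq_zero_of_frobeniusSq_eq_zero h]
    simp
  · rw [gram_frobeniusNormalize, smul_inv_smul₀ h]

theorem frobeniusSq_mul_frobeniusNormalize (B X : Matrix (Fin d) (Fin d) ℂ) :
    frobeniusSq (B * frobeniusNormalize X) = frobeniusSq (B * X) / frobeniusSq X := by
  unfold frobeniusSq
  rw [gram_mul_frobeniusNormalize, Matrix.trace_smul, Complex.smul_re, smul_eq_mul]
  unfold frobeniusSq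
  rw [div_eq_inv_mul]

theorem frobeniusSq_frobeniusNormalize {X : Matrix (Fin d) (Fin d) ℂ} (h : 0 < frobeniusSq X) :
    frobeniusSq (frobeniusNormalize X) = 1 := by
  have := frobeniusSq_mul_frobeniusNormalize 1 X
  rwa [one_mul, one_mul, div_self h.ne'] at this

theorem frobeniusSq_frobeniusNormalize_le_one (X : Matrix (Fin d) (Fin d) ℂ) :
    frobeniusSq (frobeniusNormalize X) ≤ 1 := by
  have := frobeniusSq_mul_frobeniusNormalize 1 X
  rw [one_mul, one_mul] at this
  rw [this]
  exact div_self_le_one _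

theorem continuous_frobeniusSq : Continuous (frobeniusSq : Matrix (Fin d) (Fin d) ℂ → ℝ) := by
  unfold frobeniusSq
  fun_prop

/-- The hypothesis splits `‖Z‖²` as `∑ ‖B i Z‖²`. This is the source of `λ ≤ 1` for gray
projections. -/
theorem frobeniusSq_le_of_sum_gram {ι : Type*} [Fintype ι] {B : ι → Matrix (Fin d) (Fin d) ℂ}
    (hB : ∑ i, (B i)ᴴ * B i = 1) (Z : Matrix (Fin d) (Fin d) ℂ) (i : ι) :
    frobeniusSq (B i * Z) ≤ frobeniusSq Z := by
  have h : frobeniusSq Z = ∑ i, frobeniusSq (B i * Z) := by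
    unfold frobeniusSq
    rw [← Complex.re_sum, ← Matrix.trace_sum]
    have h1 : ∀ i, (B i * Z)ᴴ * (B i * Z) = Zᴴ * ((B i)ᴴ * B i) * Z := fun i => by
      simp only [Matrix.conjTranspose_mul, Matrix.mul_assoc]
    simp only [h1]
    rw [← Finset.sum_mul, ← Finset.mul_sum, hB, Matrix.mul_one]
  rw [h]
  exact Finset.single_le_sum (f := fun i => frobeniusSq (B i * Z))
    (fun i _ => frobeniusSq_nonneg _) (Finset.mem_univ i)

theorem trace_mul_pow_comm (X Y : Matrix (Fin d) (Fin d) ℂ) (m : ℕ) :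
    ((X * Y) ^ m).trace = ((Y * X) ^ m).trace := by
  cases m with
  | zero => simp
  | succ m =>
    have h : ∀ m, (X * Y) ^ m * X = X * (Y * X) ^ m := by
      intro m
      induction m with
      | zero => simp
      | succ m ih =>
        rw [pow_succ, Matrix.mul_assoc, Matrix.mul_assoc X Y X, ← Matrix.mul_assoc _ X, ih,
          pow_succ, Matrix.mul_assoc]
    rw [pow_succ, ← Matrix.mul_assoc, h, Matrix.mul_assoc, Matrix.trace_mul_comm, pow_succ,
      Matrix.mul_assoc]

theorem exists_col_eq_smul_of_rank_le_one {Z : Matrix (Fin d) (Fin d) ℂ} (h : Z.rank ≤ 1) :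
    ∃ (v c : Fin d → ℂ), Z = Matrix.vecMulVec v c := by
  rw [Matrix.rank, finrank_le_one_iff] at h
  obtain ⟨v, hv⟩ := h
  have hc : ∀ j, ∃ c : ℂ, ∀ i, Z i j = v.1 i * c := by
    intro j
    obtain ⟨c, hc⟩ := hv ⟨Z.mulVecLin (Pi.single j 1), ⟨_, rfl⟩⟩
    refine ⟨c, fun i => ?_⟩
    have := congrFun (congrArg Subtype.val hc) i
    simp at this
    rw [← this, mul_comm]
  choose c hc using hc
  exact ⟨v.1, c, by ext i j; rw [hc, Matrix.vecMulVec_apply]⟩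

/-- A matrix `v cᵀ` of trace one is idempotent, so all its positive powers coincide. -/
theorem trace_gram_pow_eq_one_of_rank_le_one {Z : Matrix (Fin d) (Fin d) ℂ} (h : Z.rank ≤ 1)
    (hZ : (Zᴴ * Z).trace = 1) {m : ℕ} (hm : 1 ≤ m) : ((Zᴴ * Z) ^ m).trace = 1 := by
  have hr : (Zᴴ * Z).rank ≤ 1 := (Matrix.rank_mul_le_right _ _).trans h
  obtain ⟨v, c, hvc⟩ := exists_col_eq_smul_of_rank_le_one hr
  have hidem : (Zᴴ * Z) * (Zᴴ * Z) = Zᴴ * Z := by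
    rw [hvc] at hZ ⊢
    rw [Matrix.trace_vecMulVec] at hZ
    rw [Matrix.vecMulVec_mul_vecMulVec, dotProduct_comm, hZ]
    simp
  have : ∀ m : ℕ, (Zᴴ * Z) ^ (m + 1) = Zᴴ * Z := by
    intro m
    induction m with
    | zero => simp
    | succ m ih => rw [pow_succ, ih, hidem]
  obtain ⟨k, rfl⟩ := Nat.exists_eq_add_of_le' hm
  rw [this, hZ]

/-- Every matrix `Z` has a right factor `Y` for which `Z Y` is the orthogonal projection onto the
range of `Z`. -/
theorem exists_isStarProjection_mul (Z : Matrix (Fin d) (Fin d) ℂ) :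
    ∃ Y, IsStarProjection (Z * Y) ∧ Z * Y * Z = Z := by
  have hH : (Z * Zᴴ).IsHermitian := Matrix.isHermitian_mul_conjTranspose_self Z
  obtain ⟨U, D, hU, hU', hspec⟩ : ∃ (U : Matrix (Fin d) (Fin d) ℂ) (D : Fin d → ℝ),
      U * Uᴴ = 1 ∧ Uᴴ * U = 1 ∧ Z * Zᴴ = U * Matrix.diagonal (fun i => (D i : ℂ)) * Uᴴ := by
    refine ⟨hH.eigenvectorUnitary, hH.eigenvalues, ?_, ?_, ?_⟩
    · exact Unitary.coe_mul_star_self _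
    · exact Unitary.coe_star_mul_self _
    · have := hH.spectral_theorem
      rw [Unitary.conjStarAlgAut_apply] at this
      exact this
  set E := Matrix.diagonal (fun i => (D i : ℂ)) with hE
  -- Since `0⁻¹ = 0`, this is the pseudo-inverse of `E`, and `I = E F` marks the nonzero
  -- eigenvalues.
  set F := Matrix.diagonal (fun i => (D i : ℂ)⁻¹) with hF
  set I := Matrix.diagonal (fun i => if D i = 0 then (0 : ℂ) else 1) with hI
  have hEF : E * F = I := by
    rw [hE, hF, hI, Matrix.diagonal_mul_diagonal]
    congr 1
    ext i
    by_cases h : D i = 0 <;> simp [h]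
  have hIE : I * E = E := by
    rw [hE, hI, Matrix.diagonal_mul_diagonal]
    congr 1
    ext i
    by_cases h : D i = 0 <;> simp [h]
  have hII : I * I = I := by
    rw [hI, Matrix.diagonal_mul_diagonal]
    congr 1
    ext i
    by_cases h : D i = 0 <;> simp [h]
  have hIs : Iᴴ = I := by
    rw [hI, Matrix.diagonal_conjTranspose]
    congr 1
    ext i
    by_cases h : D i = 0 <;> simp [h]
  have hcancel : ∀ A B : Matrix (Fin d) (Fin d) ℂ, U * A * Uᴴ * (U * B * Uᴴ) = U * (A * B) * Uᴴ := by
    intro A B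
    calc U * A * Uᴴ * (U * B * Uᴴ) = U * A * (Uᴴ * U) * B * Uᴴ := by
          simp only [Matrix.mul_assoc]
      _ = _ := by rw [hU', Matrix.mul_one]; simp only [Matrix.mul_assoc]
  have hP : Z * (Zᴴ * (U * F * Uᴴ)) = U * I * Uᴴ := by
    rw [← Matrix.mul_assoc, hspec, hcancel, hEF]
  refine ⟨Zᴴ * (U * F * Uᴴ), ⟨?_, ?_⟩, ?_⟩
  · rw [hP, IsIdempotentElem, hcancel, hII]
  · rw [hP, IsSelfAdjoint, Matrix.star_eq_conjTranspose]
    simp only [Matrix.conjTranspose_mul, Matrix.conjTranspose_conjTranspose, hIs, Matrix.mul_assoc]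
  · rw [hP]
    have h0 : (Z - U * I * Uᴴ * Z) * (Z - U * I * Uᴴ * Z)ᴴ = 0 := by
      have h1 : (Z - U * I * Uᴴ * Z) * Zᴴ = 0 := by
        rw [Matrix.sub_mul, Matrix.mul_assoc _ Z, hspec, hcancel, hIE, sub_self]
      rw [Matrix.conjTranspose_sub, Matrix.conjTranspose_mul, Matrix.mul_sub, h1,
        ← Matrix.mul_assoc, h1, Matrix.zero_mul, sub_zero]
    exact (sub_eq_zero.1 (Matrix.self_mul_conjTranspose_eq_zero.1 h0)).symm

/-- If all `B i` act on the range of `Z` as multiples of isometries, the projection onto that range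
compresses every `(B i)ᴴ B i` to a multiple of itself. -/
theorem exists_isStarProjection_of_gram_eq {ι : Type*} {B : ι → Matrix (Fin d) (Fin d) ℂ}
    {Z : Matrix (Fin d) (Fin d) ℂ} {c : ι → ℝ}
    (h : ∀ i, (B i * Z)ᴴ * (B i * Z) = (c i : ℂ) • (Zᴴ * Z)) :
    ∃ p : Matrix (Fin d) (Fin d) ℂ, IsStarProjection p ∧ p.rank = Z.rank ∧
      ∀ i, p * (B i)ᴴ * B i * p = (c i : ℂ) • p := by
  obtain ⟨Y, hp, hZ⟩ := exists_isStarProjection_mul Z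
  refine ⟨Z * Y, hp, le_antisymm (Matrix.rank_mul_le_left _ _) ?_, fun i => ?_⟩
  · conv_lhs => rw [← hZ]
    exact Matrix.rank_mul_le_left _ _
  · have hs : (Z * Y)ᴴ = Z * Y := hp.isSelfAdjoint
    have hi : (Z * Y) * (Z * Y) = Z * Y := hp.isIdempotentElem
    calc Z * Y * (B i)ᴴ * B i * (Z * Y) = (Z * Y)ᴴ * (B i)ᴴ * B i * (Z * Y) := by rw [hs]
      _ = Yᴴ * ((B i * Z)ᴴ * (B i * Z)) * Y := by
          simp only [Matrix.conjTranspose_mul, Matrix.mul_assoc]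
      _ = (c i : ℂ) • ((Z * Y)ᴴ * (Z * Y)) := by
          rw [h, Matrix.mul_smul, Matrix.smul_mul]
          simp only [Matrix.conjTranspose_mul, Matrix.mul_assoc]
      _ = _ := by rw [hs, hi]

end GramMatrices

/-! ### Normalized Kraus products and their Gram martingale. -/

section KrausWords

open scoped Matrix ComplexOrder

variable {Ω A : Type*} [Fintype A] {d : ℕ}

theorem krausProduct_append (θ : Ω → Ω) (𝒱 : Ω → perfectKrausMeasurements A d) (ω : Ω) {n N : ℕ}
    (w : Fin n → A) (a : Fin N → A) :
    krausProduct θ 𝒱 ω (n + N) (Fin.append w a) =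
      krausProduct θ 𝒱 (θ^[n] ω) N a * krausProduct θ 𝒱 ω n w := by
  induction N with
  | zero =>
    have : (Fin.append w a : Fin (n + 0) → A) = w := by
      funext i
      exact Fin.append_left w a i
    rw [this]
    simp [krausProduct]
  | succ N ih =>
    have h : Fin.append (m := n) (n := N + 1) w a =
        Fin.snoc (α := fun _ => A) (Fin.append w (Fin.init a)) (a (Fin.last N)) := by
      rw [← Fin.append_snoc, Fin.snoc_init_self]
    change krausProduct θ 𝒱 ω (n + N + 1) (Fin.append (m := n) (n := N + 1) w a) = _
    rw [h]
    simp only [krausProduct, Fin.snoc_last, Fin.init_snoc]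
    rw [ih, Matrix.mul_assoc, ← Function.iterate_add_apply,
      show N + 1 + n = n + N + 1 by ring]

theorem sum_conjTranspose_mul_krausProduct (θ : Ω → Ω) (𝒱 : Ω → perfectKrausMeasurements A d)
    (ω : Ω) (N : ℕ) :
    ∑ a : Fin N → A, (krausProduct θ 𝒱 ω N a)ᴴ * krausProduct θ 𝒱 ω N a = 1 := by
  induction N with
  | zero => simp [krausProduct]
  | succ N ih =>
    rw [← (Fin.snocEquiv fun _ => A).sum_comp, Fintype.sum_prod_type_right, ← ih]
    refine Finset.sum_congr rfl fun w _ => ?_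
    have hV := (𝒱 (θ^[N + 1] ω)).2
    simp only [perfectKrausMeasurements, Set.mem_ofPred_eq] at hV
    have h1 : ∀ b : A, (krausProduct θ 𝒱 ω (N + 1) (Fin.snoc w b))ᴴ *
        krausProduct θ 𝒱 ω (N + 1) (Fin.snoc w b) =
        (krausProduct θ 𝒱 ω N w)ᴴ * (((𝒱 (θ^[N + 1] ω)).1 b)ᴴ * (𝒱 (θ^[N + 1] ω)).1 b) *
          krausProduct θ 𝒱 ω N w := fun b => by
      simp only [krausProduct, Fin.snoc_last, Fin.init_snoc,
        Matrix.conjTranspose_mul, Matrix.mul_assoc]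
    refine (Finset.sum_congr rfl fun b _ => h1 b).trans ?_
    rw [← Finset.sum_mul, ← Finset.mul_sum, hV, Matrix.mul_one]

/-- The normalized matrix `V_w σ`; for `ρ = σ σᴴ` it is a square root of the state of the quantum
trajectory after the outcomes `w`. -/
noncomputable def normalizedKraus (θ : Ω → Ω) (𝒱 : Ω → perfectKrausMeasurements A d)
    (σ : Matrix (Fin d) (Fin d) ℂ) (ω : Ω) (n : ℕ) (w : Fin n → A) : Matrix (Fin d) (Fin d) ℂ :=
  frobeniusNormalize (krausProduct θ 𝒱 ω n w * σ)

theorem quantumTrajectory_eq (θ : Ω → Ω) (𝒱 : Ω → perfectKrausMeasurements A d)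
    (ρ : densityMatrices d) (ω : Ω) {σ : Matrix (Fin d) (Fin d) ℂ} (hσ : σ * σᴴ = ρ.1) (n : ℕ)
    (x : ℕ → A) :
    quantumTrajectory θ 𝒱 ρ ω n x = normalizedKraus θ 𝒱 σ ω n (sequencePrefix n x) *
      (normalizedKraus θ 𝒱 σ ω n (sequencePrefix n x))ᴴ := by
  unfold quantumTrajectory normalizedKraus
  rw [frobeniusNormalize_mul_conjTranspose]
  change (let W := krausProduct θ 𝒱 ω n (sequencePrefix n x); _) = _
  set W := krausProduct θ 𝒱 ω n (sequencePrefix n x)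
  have h : W * ρ.1 * Wᴴ = (W * σ) * (W * σ)ᴴ := by
    rw [← hσ]
    simp only [Matrix.conjTranspose_mul, Matrix.mul_assoc]
  change (W * ρ.1 * Wᴴ).trace⁻¹ • (W * ρ.1 * Wᴴ) = _
  rw [h, Matrix.trace_mul_comm, ← ofReal_frobeniusSq, ← Complex.ofReal_inv]
  ext i j
  simp

/-- The ratio is the conditional probability of `a` after `w`, and it equals `‖B Z‖²`. The weight
thus cancels the new normalization, leaving an expression in `B` and `Z` alone that passes to
limits. It also holds for null words, where both sides vanish. -/
theorem weighted_increment_gram_normalizedKraus (θ : Ω → Ω)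
    (𝒱 : Ω → perfectKrausMeasurements A d) (σ : Matrix (Fin d) (Fin d) ℂ) (ω : Ω) {n N : ℕ}
    (w : Fin n → A) (a : Fin N → A) :
    (frobeniusSq (krausProduct θ 𝒱 ω (n + N) (Fin.append w a) * σ) /
      frobeniusSq (krausProduct θ 𝒱 ω n w * σ)) •
      ((normalizedKraus θ 𝒱 σ ω (n + N) (Fin.append w a))ᴴ *
        normalizedKraus θ 𝒱 σ ω (n + N) (Fin.append w a) -
      (normalizedKraus θ 𝒱 σ ω n w)ᴴ * normalizedKraus θ 𝒱 σ ω n w) =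
    (krausProduct θ 𝒱 (θ^[n] ω) N a * normalizedKraus θ 𝒱 σ ω n w)ᴴ *
        (krausProduct θ 𝒱 (θ^[n] ω) N a * normalizedKraus θ 𝒱 σ ω n w) -
      frobeniusSq (krausProduct θ 𝒱 (θ^[n] ω) N a * normalizedKraus θ 𝒱 σ ω n w) •
        ((normalizedKraus θ 𝒱 σ ω n w)ᴴ * normalizedKraus θ 𝒱 σ ω n w) := by
  simp only [normalizedKraus]
  rw [smul_sub, frobeniusSq_mul_frobeniusNormalize, gram_mul_frobeniusNormalize,
    div_eq_inv_mul, div_eq_inv_mul, mul_smul, frobeniusSq_smul_gram_frobeniusNormalize, krausProduct_append,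
    Matrix.mul_assoc]

/-- The real (`b = false`) or imaginary (`b = true`) part of an entry, as a linear functional. -/
noncomputable def matrixCoordinate (i j : Fin d) (b : Bool) : Matrix (Fin d) (Fin d) ℂ →ₗ[ℝ] ℝ :=
  (if b then Complex.imLm else Complex.reLm) ∘ₗ Matrix.entryLinearMap ℝ ℂ i j

theorem abs_matrixCoordinate_le (i j : Fin d) (b : Bool) (X : Matrix (Fin d) (Fin d) ℂ) :
    |matrixCoordinate i j b X| ≤ ‖X i j‖ := by
  cases b
  · simpa [matrixCoordinate] using Complex.abs_re_le_norm (X i j)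
  · simpa [matrixCoordinate] using Complex.abs_im_le_norm (X i j)

theorem tendsto_of_matrixCoordinate {ι : Type*} {l : Filter ι}
    {X : ι → Matrix (Fin d) (Fin d) ℂ} {Y : Matrix (Fin d) (Fin d) ℂ}
    (h : ∀ i j b, Tendsto (fun n => matrixCoordinate i j b (X n)) l
      (𝓝 (matrixCoordinate i j b Y))) : Tendsto X l (𝓝 Y) := by
  refine tendsto_pi_nhds.2 fun i => tendsto_pi_nhds.2 fun j => ?_
  have hre := (Complex.continuous_ofReal.tendsto _).comp (h i j false)
  have him := ((Complex.continuous_ofReal.tendsto _).comp (h i j true)).mul_const Complex.I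
  have := hre.add him
  simpa [matrixCoordinate, Function.comp_def, Complex.re_add_im] using this

variable [MeasurableSpace A] [MeasurableSingletonClass A]

theorem prefixProbability_quantumProbability (θ : Ω → Ω) (𝒱 : Ω → perfectKrausMeasurements A d)
    (ρ : densityMatrices d) (ω : Ω) {σ : Matrix (Fin d) (Fin d) ℂ} (hσ : σ * σᴴ = ρ.1) (n : ℕ)
    (w : Fin n → A) :
    prefixProbability (quantumProbability θ 𝒱 ρ ω) n w =
      frobeniusSq (krausProduct θ 𝒱 ω n w * σ) := by
  have h : (krausProduct θ 𝒱 ω n w * ρ.1 * (krausProduct θ 𝒱 ω n w)ᴴ).trace.re =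
      frobeniusSq (krausProduct θ 𝒱 ω n w * σ) := by
    unfold frobeniusSq
    rw [Matrix.trace_mul_comm (_ * σ)ᴴ, ← hσ]
    simp only [Matrix.conjTranspose_mul, Matrix.mul_assoc]
  rw [prefixProbability, measureReal_def, quantumProbability_cylinder, wordProbability, h,
    ENNReal.toReal_ofReal (frobeniusSq_nonneg _)]

/-- The Gram matrices of the normalized products form a bounded martingale: this is the
statement for a real coordinate `f`. -/
theorem isWordMartingale_normalizedKraus (θ : Ω → Ω) (𝒱 : Ω → perfectKrausMeasurements A d)
    (ρ : densityMatrices d) (ω : Ω) {σ : Matrix (Fin d) (Fin d) ℂ} (hσ : σ * σᴴ = ρ.1)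
    (f : Matrix (Fin d) (Fin d) ℂ →ₗ[ℝ] ℝ) :
    IsWordMartingale (quantumProbability θ 𝒱 ρ ω) fun n w =>
      f ((normalizedKraus θ 𝒱 σ ω n w)ᴴ * normalizedKraus θ 𝒱 σ ω n w) := by
  intro n N w
  have hf : ∀ (m : ℕ) (v : Fin m → A), prefixProbability (quantumProbability θ 𝒱 ρ ω) m v *
      f ((normalizedKraus θ 𝒱 σ ω m v)ᴴ * normalizedKraus θ 𝒱 σ ω m v) =
      f ((krausProduct θ 𝒱 ω m v * σ)ᴴ * (krausProduct θ 𝒱 ω m v * σ)) := fun m v => by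
    rw [prefixProbability_quantumProbability θ 𝒱 ρ ω hσ, normalizedKraus, ← smul_eq_mul,
      ← map_smul, frobeniusSq_smul_gram_frobeniusNormalize]
  simp only [hf]
  rw [← map_sum]
  congr 1
  have h : ∀ a : Fin N → A, (krausProduct θ 𝒱 ω (n + N) (Fin.append w a) * σ)ᴴ *
      (krausProduct θ 𝒱 ω (n + N) (Fin.append w a) * σ) = (krausProduct θ 𝒱 ω n w * σ)ᴴ *
      ((krausProduct θ 𝒱 (θ^[n] ω) N a)ᴴ * krausProduct θ 𝒱 (θ^[n] ω) N a) *
      (krausProduct θ 𝒱 ω n w * σ) := fun a => by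
    rw [krausProduct_append]
    simp only [Matrix.conjTranspose_mul, Matrix.mul_assoc]
  simp only [h]
  rw [← Finset.sum_mul, ← Finset.mul_sum, sum_conjTranspose_mul_krausProduct, Matrix.mul_one]

theorem ae_gram_normalizedKraus (θ : Ω → Ω) (𝒱 : Ω → perfectKrausMeasurements A d)
    (ρ : densityMatrices d) (ω : Ω) {σ : Matrix (Fin d) (Fin d) ℂ} (hσ : σ * σᴴ = ρ.1) (N : ℕ) :
    ∀ᵐ x ∂quantumProbability θ 𝒱 ρ ω,
      (∀ n, frobeniusSq (normalizedKraus θ 𝒱 σ ω n (sequencePrefix n x)) = 1) ∧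
      (∃ M, Tendsto (fun n => (normalizedKraus θ 𝒱 σ ω n (sequencePrefix n x))ᴴ *
        normalizedKraus θ 𝒱 σ ω n (sequencePrefix n x)) atTop (𝓝 M)) ∧
      ∀ a : Fin N → A, Tendsto (fun n =>
        (krausProduct θ 𝒱 (θ^[n] ω) N a * normalizedKraus θ 𝒱 σ ω n (sequencePrefix n x))ᴴ *
        (krausProduct θ 𝒱 (θ^[n] ω) N a * normalizedKraus θ 𝒱 σ ω n (sequencePrefix n x)) -
        frobeniusSq (krausProduct θ 𝒱 (θ^[n] ω) N a *
            normalizedKraus θ 𝒱 σ ω n (sequencePrefix n x)) •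
          ((normalizedKraus θ 𝒱 σ ω n (sequencePrefix n x))ᴴ *
            normalizedKraus θ 𝒱 σ ω n (sequencePrefix n x))) atTop (𝓝 0) := by
  have hmart := fun i j b =>
    isWordMartingale_normalizedKraus θ 𝒱 ρ ω hσ (matrixCoordinate i j b)
  have hbound : ∀ i j b n (w : Fin n → A), |matrixCoordinate i j b
      ((normalizedKraus θ 𝒱 σ ω n w)ᴴ * normalizedKraus θ 𝒱 σ ω n w)| ≤ 1 := fun i j b n w =>
    (abs_matrixCoordinate_le i j b _).trans ((norm_gram_entry_le_frobeniusSq _ i j).trans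
      (frobeniusSq_frobeniusNormalize_le_one _))
  have hconv : ∀ᵐ x ∂quantumProbability θ 𝒱 ρ ω, ∀ i j b, ∃ c, Tendsto (fun n =>
      matrixCoordinate i j b ((normalizedKraus θ 𝒱 σ ω n (sequencePrefix n x))ᴴ *
        normalizedKraus θ 𝒱 σ ω n (sequencePrefix n x))) atTop (𝓝 c) := by
    simp only [ae_all_iff]
    exact fun i j b => (hmart i j b).ae_exists_tendsto (hbound i j b)
  have hincr := ae_all_iff.2 fun i => ae_all_iff.2 fun j => ae_all_iff.2 fun b =>
    ae_all_iff.2 fun a : Fin N → A =>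
      (hmart i j b).ae_tendsto_weighted_increment (hbound i j b) a
  filter_upwards [ae_prefixProbability_pos (quantumProbability θ 𝒱 ρ ω), hconv, hincr]
    with x hpos hc hi
  refine ⟨fun n => ?_, ?_, fun a => ?_⟩
  · have := hpos n
    rw [prefixProbability_quantumProbability θ 𝒱 ρ ω hσ] at this
    exact frobeniusSq_frobeniusNormalize this
  · choose c hc using hc
    -- The limit is assembled from the limits of real and imaginary parts of the entries.
    refine ⟨fun i j => ⟨c i j false, c i j true⟩, tendsto_of_matrixCoordinate fun i j b => ?_⟩
    convert hc i j b using 2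
    cases b <;> rfl
  · refine tendsto_of_matrixCoordinate fun i j b => ?_
    rw [map_zero]
    refine (hi i j b a).congr fun n => ?_
    rw [← weighted_increment_gram_normalizedKraus, map_smul, map_sub, smul_eq_mul,
      prefixProbability_quantumProbability θ 𝒱 ρ ω hσ,
      prefixProbability_quantumProbability θ 𝒱 ρ ω hσ]

end KrausWords

/-! ### Poincaré recurrence. -/

section Recurrence

/-- Poincaré recurrence for the values of an observable. -/
theorem ae_mapClusterPt_iterate {Ω E : Type*} [MeasurableSpace Ω] {Pr : Measure Ω}
    [IsFiniteMeasure Pr] {θ : Ω → Ω} (hθ : MeasurePreserving θ Pr Pr) [TopologicalSpace E]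
    [SecondCountableTopology E] [MeasurableSpace E] [OpensMeasurableSpace E] {Φ : Ω → E}
    (hΦ : Measurable Φ) :
    ∀ᵐ ω ∂Pr, MapClusterPt (Φ ω) atTop fun n => Φ (θ^[n] ω) := by
  -- With the topology pulled back along `Φ`, topological recurrence of points of `Ω` is recurrence
  -- of the values of `Φ`.
  let _ : TopologicalSpace Ω := TopologicalSpace.induced Φ inferInstance
  have : SecondCountableTopology Ω := TopologicalSpace.secondCountableTopology_induced Ω E Φ
  have : OpensMeasurableSpace Ω := by
    refine ⟨MeasurableSpace.generateFrom_le ?_⟩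
    rintro s ⟨t, ht, rfl⟩
    exact hΦ ht.measurableSet
  filter_upwards [hθ.conservative.ae_frequently_mem_of_mem_nhds] with ω hω
  rw [mapClusterPt_iff_frequently]
  exact fun s hs => hω _ (continuous_induced_dom.continuousAt hs)

end Recurrence

/-! ### Passage to the limit and the gray projection. -/

section GrayProjections

open scoped Matrix ComplexOrder

variable {Ω A : Type*} [Fintype A] {d : ℕ}

theorem measurable_krausProduct [MeasurableSpace Ω] {θ : Ω → Ω} (hθ : Measurable θ)
    {𝒱 : Ω → perfectKrausMeasurements A d}
    (h𝒱 : ∀ (a : A) (i j : Fin d), Measurable fun ω => (𝒱 ω).1 a i j) (N : ℕ)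
    (a : Fin N → A) (i j : Fin d) : Measurable fun ω => krausProduct θ 𝒱 ω N a i j := by
  induction N generalizing i j with
  | zero => exact measurable_const
  | succ N ih =>
    simp only [krausProduct, Matrix.mul_apply]
    exact Finset.measurable_sum _ fun k _ =>
      ((h𝒱 _ i k).comp (hθ.iterate (N + 1))).mul (ih _ k j)

open scoped MatrixOrder Matrix.Norms.L2Operator in
theorem exists_mul_conjTranspose_eq (ρ : densityMatrices d) :
    ∃ σ : Matrix (Fin d) (Fin d) ℂ, σ * σᴴ = ρ.1 := by
  obtain ⟨σ, hσ⟩ := CStarAlgebra.nonneg_iff_eq_mul_star_self.1 ρ.2.1.nonneg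
  exact ⟨σ, hσ.symm⟩

theorem isCompact_frobeniusSq_eq_one :
    IsCompact {Z : Matrix (Fin d) (Fin d) ℂ | frobeniusSq Z = 1} := by
  have h : IsCompact (Set.pi Set.univ fun _ : Fin d => Set.pi Set.univ fun _ : Fin d =>
      Metric.closedBall (0 : ℂ) 1) :=
    isCompact_univ_pi fun _ => isCompact_univ_pi fun _ => isCompact_closedBall 0 1
  refine IsCompact.of_isClosed_subset (X := Matrix (Fin d) (Fin d) ℂ) h
    (isClosed_singleton.preimage continuous_frobeniusSq) ?_
  intro Z hZ i _ j _
  have h1 := norm_sq_entry_le_frobeniusSq Z i j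
  rw [Set.mem_ofPred_eq] at hZ
  rw [hZ] at h1
  simpa using (sq_le_one_iff₀ (norm_nonneg _)).1 h1

/-- A limit point of normalized matrices whose Gram matrices are asymptotically preserved, up to
scaling, by the word operators at a recurrent environment gives a gray projection. -/
theorem grayProjections_nonempty_of_tendsto {θ : Ω → Ω} {𝒱 : Ω → perfectKrausMeasurements A d}
    {ω : Ω} {N : ℕ}
    (hrec : MapClusterPt (fun a : Fin N → A => krausProduct θ 𝒱 ω N a) atTop
      fun n (a : Fin N → A) => krausProduct θ 𝒱 (θ^[n] ω) N a)
    {Z : ℕ → Matrix (Fin d) (Fin d) ℂ} (hZ : ∀ n, frobeniusSq (Z n) = 1)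
    {M : Matrix (Fin d) (Fin d) ℂ} (hM : Tendsto (fun n => (Z n)ᴴ * Z n) atTop (𝓝 M))
    (hincr : ∀ a : Fin N → A, Tendsto (fun n =>
      (krausProduct θ 𝒱 (θ^[n] ω) N a * Z n)ᴴ * (krausProduct θ 𝒱 (θ^[n] ω) N a * Z n) -
        frobeniusSq (krausProduct θ 𝒱 (θ^[n] ω) N a * Z n) • ((Z n)ᴴ * Z n)) atTop (𝓝 0))
    {m : ℕ} (hm : 1 ≤ m) (hMm : (M ^ m).trace ≠ 1) : (grayProjections θ 𝒱 N ω).Nonempty := by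
  have : FirstCountableTopology (Matrix (Fin d) (Fin d) ℂ) :=
    inferInstanceAs (FirstCountableTopology (Fin d → Fin d → ℂ))
  obtain ⟨φ, hφ, hφB⟩ := hrec.tendsto_subseq
  -- `Z` itself need not converge, only its Gram matrices do; a second extraction along the return
  -- times `φ` provides a limit `Y`.
  obtain ⟨Y, hY, ψ, hψ, hψZ⟩ :=
    isCompact_frobeniusSq_eq_one.tendsto_subseq fun n => hZ (φ n)
  have hφψ : Tendsto (fun n => φ (ψ n)) atTop atTop := hφ.tendsto_atTop.comp hψ.tendsto_atTop
  have hZY : Tendsto (fun n => Z (φ (ψ n))) atTop (𝓝 Y) := hψZ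
  have hB : ∀ a : Fin N → A, Tendsto (fun n => krausProduct θ 𝒱 (θ^[φ (ψ n)] ω) N a) atTop
      (𝓝 (krausProduct θ 𝒱 ω N a)) := fun a =>
    (tendsto_pi_nhds.1 hφB a).comp hψ.tendsto_atTop
  have hgramc : Continuous fun X : Matrix (Fin d) (Fin d) ℂ => Xᴴ * X := by fun_prop
  have hYM : Yᴴ * Y = M :=
    tendsto_nhds_unique ((hgramc.tendsto Y).comp hZY) (hM.comp hφψ)
  have hgram : ∀ a : Fin N → A, (krausProduct θ 𝒱 ω N a * Y)ᴴ * (krausProduct θ 𝒱 ω N a * Y) =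
      (frobeniusSq (krausProduct θ 𝒱 ω N a * Y) : ℂ) • (Yᴴ * Y) := by
    intro a
    have hBZ : Tendsto (fun n => krausProduct θ 𝒱 (θ^[φ (ψ n)] ω) N a * Z (φ (ψ n))) atTop
        (𝓝 (krausProduct θ 𝒱 ω N a * Y)) := (hB a).mul hZY
    have h1 := ((hgramc.tendsto _).comp hBZ).sub
      (((continuous_frobeniusSq.tendsto _).comp hBZ).smul ((hgramc.tendsto Y).comp hZY))
    have h2 := tendsto_nhds_unique h1 ((hincr a).comp hφψ)
    rw [sub_eq_zero] at h2
    rw [h2]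
    ext i j
    simp
  obtain ⟨p, hp, hrank, hgray⟩ := exists_isStarProjection_of_gram_eq hgram
  have htr : (Yᴴ * Y).trace = 1 := by
    rw [← ofReal_frobeniusSq, hY]
    simp
  -- Rank at most one would make every moment of `Yᴴ Y = M` equal to `1`.
  have hrank2 : 2 ≤ Y.rank := by
    by_contra h
    refine hMm ?_
    rw [← hYM]
    exact trace_gram_pow_eq_one_of_rank_le_one (by omega) htr hm
  refine ⟨p, Set.mem_biUnion (x := p.rank) ⟨by rwa [hrank], ?_⟩ ⟨hp, rfl, fun a =>
    ⟨_, frobeniusSq_nonneg _, ?_, hgray a⟩⟩⟩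
  · simpa using p.rank_le_width
  · rw [← show frobeniusSq Y = 1 from hY]
    exact frobeniusSq_le_of_sum_gram (sum_conjTranspose_mul_krausProduct θ 𝒱 ω N) Y a

theorem grayProjections_nonempty_of_notMem_purificationEvent [MeasurableSpace A]
    [MeasurableSingletonClass A] {θ : Ω → Ω} {𝒱 : Ω → perfectKrausMeasurements A d} {ω : Ω}
    {N : ℕ}
    (hrec : MapClusterPt (fun a : Fin N → A => krausProduct θ 𝒱 ω N a) atTop
      fun n (a : Fin N → A) => krausProduct θ 𝒱 (θ^[n] ω) N a)
    (hω : ω ∉ purificationEvent θ 𝒱) : (grayProjections θ 𝒱 N ω).Nonempty := by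
  simp only [purificationEvent, Set.mem_ofPred_eq, not_forall] at hω
  obtain ⟨ρ, hρ⟩ := hω
  obtain ⟨σ, hσ⟩ := exists_mul_conjTranspose_eq ρ
  -- Failure of purification is not a null event, so it meets the almost sure event; one such
  -- sequence suffices.
  obtain ⟨x, hx, hnorm, ⟨M, hM⟩, hincr⟩ :=
    ((not_eventually.1 hρ).and_eventually (ae_gram_normalizedKraus θ 𝒱 ρ ω hσ N)).exists
  simp only [not_forall] at hx
  obtain ⟨m, hm, hx⟩ := hx
  refine grayProjections_nonempty_of_tendsto hrec hnorm hM hincr hm fun hMm => hx ?_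
  have hc : Continuous fun X : Matrix (Fin d) (Fin d) ℂ => (X ^ m).trace := by fun_prop
  have h := (hc.tendsto M).comp hM
  rw [hMm] at h
  refine h.congr fun n => ?_
  rw [quantumTrajectory_eq θ 𝒱 ρ ω hσ, trace_mul_pow_comm]
  rfl

end GrayProjections

theorem mainTheorem3 {Ω : Type*} [MeasurableSpace Ω] (Pr : Measure Ω) [IsProbabilityMeasure Pr]
    (θ : Ω ≃ᵐ Ω) (hθ : Ergodic θ Pr)
    {A : Type*} [Fintype A] [MeasurableSpace A] [MeasurableSingletonClass A] (d : ℕ)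
    (𝒱 : Ω → perfectKrausMeasurements A d)
    (h𝒱 : ∀ (a : A) (i j : Fin d), Measurable fun ω => (𝒱 ω).1 a i j) (N : ℕ) :
    ∀ᵐ ω ∂Pr, ω ∉ purificationEvent θ 𝒱 → (grayProjections θ 𝒱 N ω).Nonempty := by
  -- All words of length `N` enter one observable, so that common return times serve them
  -- simultaneously.
  have hΦ : Measurable fun (ω : Ω) (a : Fin N → A) (i j : Fin d) => krausProduct θ 𝒱 ω N a i j :=
    measurable_pi_lambda _ fun a => measurable_pi_lambda _ fun i => measurable_pi_lambda _ fun j =>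
      measurable_krausProduct θ.measurable h𝒱 N a i j
  filter_upwards [ae_mapClusterPt_iterate hθ.toMeasurePreserving hΦ] with ω hrec hω
  exact grayProjections_nonempty_of_notMem_purificationEvent hrec hω
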